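/- Let $\mathsf{GLP}$ be the propositional polymodal logic whose language has propositional variables, the Boolean connectives and one modality $[\alpha]$ for each ordinal $\alpha$ (with $\langle\alpha\rangle\varphi := \neg[\alpha]\neg\varphi$), whose axioms are all classical propositional tautologies in this language and all instances of the schemata $$[\alpha](\chi\to\psi)\to([\alpha]\chi\to[\alpha]\psi),\qquad [\alpha]([\alpha]\chi\to\chi)\to[\alpha]\chi,$$ $$\langle\alpha\rangle\psi\to[\beta]\langle\alpha\rangle\psi\ \ (\alpha<\beta),\qquad [\alpha]\psi\to[\beta]\psi\ \ (\alpha\le\beta),$$ and whose rules are modus ponens and necessitation $\psi/[\alpha]\psi$ for each ordinal $\alpha$. Let $S$ be the class of worms, that is, the least class of formulas that contains $\top$ and contains $\langle\alpha\rangle A$ whenever it contains $A$ and $\alpha$ is an ordinal. For an ordinal $\alpha$ and worms $A,B\in S$ write $A<_\alpha B$ if $\mathsf{GLP}\vdash B\to\langle\alpha\rangle A$. Then for every ordinal $\alpha$ the relation $<_\alpha$ on the whole class $S$ is well-founded: every non-empty subclass of $S$ has a $<_\alpha$-minimal element (equivalently, there is no infinite descending chain $\cdots<_\alpha A_2<_\alpha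 A_1<_\alpha A_0$ of worms). -/

import Mathlib

universe u

namespace GLP

/-- Formulas of the class-size polymodal language: propositional variables `var n`, falsum,
implication, and one modality `box α`, i.e. `[α]`, for each ordinal `α`. -/
inductive Formula : Type (u + 1)
  | var (n : ℕ) : Formula
  | bot : Formula
  | imp (φ ψ : Formula) : Formula
  | box (α : Ordinal.{u}) (φ : Formula) : Formula

namespace Formula

/-- Negation `¬ φ`. -/
def neg (φ : Formula.{u}) : Formula.{u} := imp φ bot

/-- Verum `⊤`. -/
def top : Formula.{u} := neg bot

/-- The dual modality `⟨α⟩ φ`, i.e. `¬ [α] ¬ φ`. -/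
def dia (α : Ordinal.{u}) (φ : Formula.{u}) : Formula.{u} := neg (box α (neg φ))

/-- Truth value of a formula under a propositional valuation `v`, in which the variables and the
boxed formulas count as atoms; only the values of `v` at these atoms are used. -/
def eval (v : Formula.{u} → Prop) : Formula.{u} → Prop
  | var n => v (var n)
  | bot => False
  | imp φ ψ => eval v φ → eval v ψ
  | box α φ => v (box α φ)

/-- Classical propositional tautologies in the polymodal language. -/
def IsTautology (φ : Formula.{u}) : Prop := ∀ v : Formula.{u} → Prop, eval v φ

end Formula

open Formula in
/-- Theorems of the logic `GLP` with one modality for each ordinal. -/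
inductive Provable : Formula.{u} → Prop
  | taut {φ : Formula.{u}} (h : IsTautology φ) : Provable φ
  | distrib (α : Ordinal.{u}) (χ ψ : Formula.{u}) :
      Provable (imp (box α (imp χ ψ)) (imp (box α χ) (box α ψ)))
  | loeb (α : Ordinal.{u}) (χ : Formula.{u}) :
      Provable (imp (box α (imp (box α χ) χ)) (box α χ))
  | dia_box {α β : Ordinal.{u}} (h : α < β) (ψ : Formula.{u}) :
      Provable (imp (dia α ψ) (box β (dia α ψ)))
  | monotone {α β : Ordinal.{u}} (h : α ≤ β) (ψ : Formula.{u}) :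
      Provable (imp (box α ψ) (box β ψ))
  | mp {φ ψ : Formula.{u}} (h₁ : Provable (imp φ ψ)) (h₂ : Provable φ) : Provable ψ
  | nec (α : Ordinal.{u}) {φ : Formula.{u}} (h : Provable φ) : Provable (box α φ)

/-- The formulas that are worms: `⊤`, and `⟨α⟩ A` for each worm `A` and each ordinal `α`. -/
inductive IsWorm : Formula.{u} → Prop
  | top : IsWorm Formula.top
  | dia (α : Ordinal.{u}) {A : Formula.{u}} (h : IsWorm A) : IsWorm (Formula.dia α A)

/-- The class `S` of all worms. -/
def S : Set Formula.{u} := {A | IsWorm A}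

/-- `wormLT α A B`, i.e. `A <_α B`, says that `GLP ⊢ B → ⟨α⟩ A`. -/
def wormLT (α : Ordinal.{u}) (A B : Formula.{u}) : Prop :=
  Provable (Formula.imp B (Formula.dia α A))

end GLP

namespace GLP

open Formula Filter Topology Set

/-! ### Derived rules -/

/-! Since `⟨α⟩A` implies `⟨0⟩A`, it suffices to treat `<_0`. Cut a nonempty worm at the first
occurrence of its least modality `m`: it is equivalent to `h ∧ ⟨m⟩b`, where all modalities of `h`
exceed `m`. Recursion on this cut gives comparability under `<_m` of worms with modalities at least
`m` (`comparable`). Irreflexivity follows by Löb from the consistency of worms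
(`not_provable_neg_worm`), obtained from a neighbourhood model on the ordinals.

If `<_0` were ill-founded, there would be minimal bad worms: inaccessible, with every shorter worm
weakly below them accessible. Take one, `h m b`, with `m` least possible, and induct on its
accessible head `h`. Some minimal bad `A` lies strictly below it. As `b` is accessible,
comparability forces `A → ⟨m⟩b`. So `A` is not weakly above `h` at level `m+1`, or it would be
weakly above `h m b`. Hence either `A` itself lies below `h` and is accessible, or `A` has least
modality `m` and a head below `h`, which the induction excludes. -/

/-- `Entails φ ψ` says that `GLP ⊢ φ → ψ`. -/
def Entails (φ ψ : Formula.{u}) : Prop := Provable (imp φ ψ)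

/-- Conjunction. -/
def Formula.conj (φ ψ : Formula.{u}) : Formula.{u} := neg (imp φ (neg ψ))

namespace Entails

variable {φ ψ χ θ : Formula.{u}} {a b : Ordinal.{u}}

theorem of_eval (h : ∀ v, eval v φ → eval v ψ) : Entails φ ψ := Provable.taut fun v => h v

theorem refl (φ : Formula.{u}) : Entails φ φ := of_eval fun _ => id

theorem trans (h₁ : Entails φ ψ) (h₂ : Entails ψ χ) : Entails φ χ := by
  have t : Provable (imp (imp φ ψ) (imp (imp ψ χ) (imp φ χ))) :=
    Provable.taut fun v => by simp only [eval]; tauto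
  exact (t.mp h₁).mp h₂

theorem intro (h₁ : Entails φ ψ) (h₂ : Entails φ χ) : Entails φ (conj ψ χ) := by
  have t : Provable (imp (imp φ ψ) (imp (imp φ χ) (imp φ (conj ψ χ)))) :=
    Provable.taut fun v => by simp only [eval, conj, neg]; tauto
  exact (t.mp h₁).mp h₂

theorem conj_left (φ ψ : Formula.{u}) : Entails (conj φ ψ) φ :=
  of_eval fun v => by simp only [eval, conj, neg]; tauto

theorem conj_right (φ ψ : Formula.{u}) : Entails (conj φ ψ) ψ :=
  of_eval fun v => by simp only [eval, conj, neg]; tauto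

theorem curry (h : Entails (conj φ ψ) χ) : Entails φ (imp ψ χ) := by
  have t : Provable (imp (imp (conj φ ψ) χ) (imp φ (imp ψ χ))) :=
    Provable.taut fun v => by simp only [eval, conj, neg]; tauto
  exact t.mp h

theorem contra (h : Entails φ ψ) : Entails (neg ψ) (neg φ) := by
  have t : Provable (imp (imp φ ψ) (imp (neg ψ) (neg φ))) :=
    Provable.taut fun v => by simp only [eval, neg]; tauto
  exact t.mp h

theorem to_top (φ : Formula.{u}) : Entails φ top :=
  of_eval fun v => by simp only [eval, top, neg]; tauto

theorem box_mono (a : Ordinal.{u}) (h : Entails φ ψ) : Entails (box a φ) (box a ψ) :=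
  (Provable.distrib a φ ψ).mp (Provable.nec a h)

theorem dia_mono (a : Ordinal.{u}) (h : Entails φ ψ) : Entails (dia a φ) (dia a ψ) :=
  (box_mono a h.contra).contra

theorem dia_of_le (h : a ≤ b) (φ : Formula.{u}) : Entails (dia b φ) (dia a φ) :=
  contra (Provable.monotone h (neg φ))

/-- Transitivity, from Löb's axiom for `φ ∧ [a]φ`. -/
theorem box_box (a : Ordinal.{u}) (φ : Formula.{u}) : Entails (box a φ) (box a (box a φ)) := by
  have h₁ : Entails φ (imp (box a (conj φ (box a φ))) (conj φ (box a φ))) :=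
    curry (intro (conj_left _ _) ((conj_right _ _).trans (box_mono a (conj_left _ _))))
  exact ((box_mono a h₁).trans (Provable.loeb a _)).trans (box_mono a (conj_right _ _))

theorem to_neg_neg (φ : Formula.{u}) : Entails φ (neg (neg φ)) :=
  of_eval fun v => by simp only [eval, neg]; tauto

theorem dia_dia (a : Ordinal.{u}) (φ : Formula.{u}) : Entails (dia a (dia a φ)) (dia a φ) :=
  ((box_box a (neg φ)).trans (box_mono a (to_neg_neg _))).contra

theorem trans_dia (h₁ : Entails φ (dia a ψ)) (h₂ : Entails ψ (dia a χ)) : Entails φ (dia a χ) :=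
  (h₁.trans (dia_mono a h₂)).trans (dia_dia a χ)

theorem dia_conj_box (a : Ordinal.{u}) (φ ψ : Formula.{u}) :
    Entails (conj (dia a φ) (box a ψ)) (dia a (conj φ ψ)) := by
  have h₁ : Entails (neg (conj φ ψ)) (imp ψ (neg φ)) :=
    of_eval fun v => by simp only [eval, conj, neg]; tauto
  have h₂ : Entails (box a (neg (conj φ ψ))) (imp (box a ψ) (box a (neg φ))) :=
    (box_mono a h₁).trans (Provable.distrib a ψ (neg φ))
  have t : Provable (imp (imp (box a (neg (conj φ ψ))) (imp (box a ψ) (box a (neg φ))))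
      (imp (conj (dia a φ) (box a ψ)) (dia a (conj φ ψ)))) :=
    Provable.taut fun v => by
      simp only [conj, dia, neg, eval]
      tauto
  exact t.mp h₂

/-- As `⟨a⟩ψ` implies `[b]⟨a⟩ψ`, it can be carried under `⟨b⟩`. -/
theorem dia_conj_dia (h : a < b) (φ ψ : Formula.{u}) :
    Entails (conj (dia b φ) (dia a ψ)) (dia b (conj φ (dia a ψ))) :=
  (intro (conj_left _ _) ((conj_right _ _).trans (Provable.dia_box h ψ))).trans
    (dia_conj_box b φ (dia a ψ))

/-- Contraposition gives `[a]¬φ → ¬φ`, and Löb's rule applies. This is the source of irreflexivity.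
-/
theorem refutable (h : Entails φ (dia a φ)) : Provable (neg φ) := by
  have t : Provable (imp (imp φ (dia a φ)) (imp (box a (neg φ)) (neg φ))) :=
    Provable.taut fun v => by simp only [dia, neg, eval]; tauto
  have h₁ := t.mp h
  exact h₁.mp ((Provable.loeb a (neg φ)).mp (Provable.nec a h₁))

end Entails

/-! ### Worms as lists of ordinals -/

/-- The worm with the given list of modalities, outermost first. -/
def worm : List Ordinal.{u} → Formula.{u}
  | [] => top
  | a :: l => dia a (worm l)

theorem IsWorm.exists_list {A : Formula.{u}} (h : IsWorm A) : ∃ l, worm l = A := by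
  induction h with
  | top => exact ⟨[], rfl⟩
  | dia α _ ih =>
    obtain ⟨l, rfl⟩ := ih
    exact ⟨α :: l, rfl⟩

open Entails

theorem worm_append_left (h t : List Ordinal.{u}) : Entails (worm (h ++ t)) (worm h) := by
  induction h with
  | nil => exact to_top _
  | cons a h ih => exact dia_mono a ih

theorem worm_append_right {m : Ordinal.{u}} {h : List Ordinal.{u}} (hh : ∀ x ∈ h, m < x)
    (b : List Ordinal.{u}) : Entails (worm (h ++ m :: b)) (dia m (worm b)) := by
  induction h with
  | nil => exact refl _
  | cons a h ih =>
    rw [List.forall_mem_cons] at hh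
    exact ((dia_mono a (ih hh.2)).trans (dia_of_le hh.1.le _)).trans (dia_dia _ _)

/-- Converse of the two preceding lemmas: a worm cut at `m` is equivalent to the conjunction of its
head and `⟨m⟩` of its remainder. -/
theorem worm_append_of_conj {m : Ordinal.{u}} {h : List Ordinal.{u}} (hh : ∀ x ∈ h, m < x)
    (b : List Ordinal.{u}) :
    Entails (conj (worm h) (dia m (worm b))) (worm (h ++ m :: b)) := by
  induction h with
  | nil => exact conj_right _ _
  | cons a h ih =>
    rw [List.forall_mem_cons] at hh
    exact (dia_conj_dia hh.1 _ _).trans (dia_mono a (ih hh.2))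

/-- `Above m A B` says that `B` implies `A` or `⟨m⟩ A`. -/
def Above (m : Ordinal.{u}) (A B : List Ordinal.{u}) : Prop :=
  Entails (worm B) (worm A) ∨ Entails (worm B) (dia m (worm A))

theorem Above.mono {m n : Ordinal.{u}} (hmn : m ≤ n) {A B : List Ordinal.{u}} (h : Above n A B) :
    Above m A B :=
  h.imp id fun h => h.trans (dia_of_le hmn _)

theorem Above.trans {m : Ordinal.{u}} {A B C : List Ordinal.{u}} (h₁ : Above m A B)
    (h₂ : Above m B C) : Above m A C := by
  rcases h₁ with h₁ | h₁ <;> rcases h₂ with h₂ | h₂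
  · exact .inl (h₂.trans h₁)
  · exact .inr (h₂.trans (dia_mono m h₁))
  · exact .inr (h₂.trans h₁)
  · exact .inr (h₂.trans_dia h₁)

/-- A worm above the head of `h ++ m :: b` and strictly above its remainder is above all of it. -/
theorem Above.append {m : Ordinal.{u}} {h b C : List Ordinal.{u}} (hh : ∀ x ∈ h, m < x)
    (h₁ : Above (Order.succ m) h C) (h₂ : Entails (worm C) (dia m (worm b))) :
    Above (Order.succ m) (h ++ m :: b) C := by
  rcases h₁ with h₁ | h₁
  · exact .inl ((h₁.intro h₂).trans (worm_append_of_conj hh b))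
  · exact .inr (((h₁.intro h₂).trans (dia_conj_dia (Order.lt_succ m) _ _)).trans
      (dia_mono _ (worm_append_of_conj hh b)))

theorem exists_split {m : Ordinal.{u}} {A : List Ordinal.{u}} (hA : ∀ x ∈ A, m ≤ x)
    (hm : m ∈ A) : ∃ h b, A = h ++ m :: b ∧ (∀ x ∈ h, m < x) ∧ ∀ x ∈ b, m ≤ x := by
  induction A with
  | nil => simp at hm
  | cons a A ih =>
    rw [List.forall_mem_cons] at hA
    by_cases ham : a = m
    · subst ham
      exact ⟨[], A, rfl, by simp, hA.2⟩
    · obtain ⟨h, b, rfl, hh, hb⟩ := ih hA.2 (by simpa [Ne.symm ham] using hm)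
      exact ⟨a :: h, b, rfl, List.forall_mem_cons.2 ⟨lt_of_le_of_ne hA.1 (Ne.symm ham), hh⟩, hb⟩

theorem exists_min_mem {A : List Ordinal.{u}} (hA : A ≠ []) : ∃ m ∈ A, ∀ x ∈ A, m ≤ x := by
  obtain ⟨m, hm, h⟩ := WellFounded.has_min (wellFounded_lt (α := Ordinal.{u})) {x | x ∈ A}
    (List.exists_mem_of_ne_nil A hA)
  exact ⟨m, hm, fun x hx => not_lt.1 (h x hx)⟩

/-- Trichotomy: `A <_m B`, or `B <_m A`, or `A` and `B` are provably equivalent. -/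
def Comparable (m : Ordinal.{u}) (A B : List Ordinal.{u}) : Prop :=
  Entails (worm B) (dia m (worm A)) ∨ Entails (worm A) (dia m (worm B)) ∨
    (Entails (worm A) (worm B) ∧ Entails (worm B) (worm A))

theorem Comparable.symm {m : Ordinal.{u}} {A B : List Ordinal.{u}} (h : Comparable m A B) :
    Comparable m B A := by
  unfold Comparable at *
  tauto

theorem Comparable.mono {m n : Ordinal.{u}} (hmn : m ≤ n) {A B : List Ordinal.{u}}
    (h : Comparable n A B) : Comparable m A B :=
  h.imp (fun h => h.trans (dia_of_le hmn _)) (Or.imp_left fun h => h.trans (dia_of_le hmn _))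

theorem Comparable.lt_or_above {m : Ordinal.{u}} {A B : List Ordinal.{u}} (h : Comparable m A B) :
    Entails (worm B) (dia m (worm A)) ∨ Above m B A := by
  unfold Comparable Above at *
  tauto

/-- Induction on total length, cutting at the least modality present. If neither remainder settles
the matter, each worm implies `⟨m⟩` of the other's remainder, and comparing the heads at level `m+1`
decides. -/
theorem comparable_aux (n : ℕ) : ∀ (m : Ordinal.{u}) (A B : List Ordinal.{u}),
    A.length + B.length ≤ n → (∀ x ∈ A, m ≤ x) → (∀ x ∈ B, m ≤ x) → Comparable m A B := by
  induction n with
  | zero =>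
    intro m A B hn _ _
    obtain rfl : A = [] := List.length_eq_zero_iff.1 (by omega)
    obtain rfl : B = [] := List.length_eq_zero_iff.1 (by omega)
    exact .inr (.inr ⟨refl _, refl _⟩)
  | succ n ih =>
    have key : ∀ (m : Ordinal.{u}) (A B : List Ordinal.{u}), A.length + B.length ≤ n + 1 →
        (∀ x ∈ A, m ≤ x) → (∀ x ∈ B, m ≤ x) → m ∈ A → Comparable m A B := by
      intro m A B hn hA hB hmA
      obtain ⟨h, b, rfl, hh, hb⟩ := exists_split hA hmA
      simp only [List.length_append, List.length_cons] at hn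
      rcases (ih m b B (by omega) hb hB).lt_or_above with h₁ | h₁
      swap
      · refine .inr (.inl ((worm_append_right hh b).trans ?_))
        rcases h₁ with h₁ | h₁
        · exact dia_mono m h₁
        · exact (refl _).trans_dia h₁
      by_cases hmB : m ∈ B
      · obtain ⟨h', b', rfl, hh', hb'⟩ := exists_split hB hmB
        simp only [List.length_append, List.length_cons] at hn
        rcases (ih m b' (h ++ m :: b) (by simp; omega) hb' hA).lt_or_above with h₂ | h₂
        swap
        · refine .inl ((worm_append_right hh' b').trans ?_)
          rcases h₂ with h₂ | h₂
          · exact dia_mono m h₂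
          · exact (refl _).trans_dia h₂
        have hd := dia_of_le (Order.le_succ m)
        rcases ih (Order.succ m) h h' (by omega) (fun x hx => Order.succ_le_of_lt (hh x hx))
          (fun x hx => Order.succ_le_of_lt (hh' x hx)) with h₃ | h₃ | h₃
        · refine .inl ((((worm_append_left _ _).trans h₃).intro h₁).trans
            ((dia_conj_dia (Order.lt_succ m) _ _).trans
              ((dia_mono _ (worm_append_of_conj hh b)).trans (hd _))))
        · refine .inr (.inl ((((worm_append_left _ _).trans h₃).intro h₂).trans
            ((dia_conj_dia (Order.lt_succ m) _ _).trans
              ((dia_mono _ (worm_append_of_conj hh' b')).trans (hd _)))))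
        · exact .inr (.inr ⟨(((worm_append_left _ _).trans h₃.1).intro h₂).trans
              (worm_append_of_conj hh' b'),
            (((worm_append_left _ _).trans h₃.2).intro h₁).trans (worm_append_of_conj hh b)⟩)
      · have hd := dia_of_le (Order.le_succ m)
        have hB' : ∀ x ∈ B, m < x := fun x hx =>
          lt_of_le_of_ne (hB x hx) fun e => hmB (e ▸ hx)
        rcases ih (Order.succ m) h B (by omega) (fun x hx => Order.succ_le_of_lt (hh x hx))
          (fun x hx => Order.succ_le_of_lt (hB' x hx)) with h₃ | h₃ | h₃
        · exact .inl ((h₃.intro h₁).trans ((dia_conj_dia (Order.lt_succ m) _ _).trans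
              ((dia_mono _ (worm_append_of_conj hh b)).trans (hd _))))
        · exact .inr (.inl ((worm_append_left _ _).trans (h₃.trans (hd _))))
        · exact .inr (.inr ⟨(worm_append_left _ _).trans h₃.1,
            (h₃.2.intro h₁).trans (worm_append_of_conj hh b)⟩)
    intro m A B hn hA hB
    by_cases hne : A ++ B = []
    · obtain ⟨rfl, rfl⟩ := List.append_eq_nil_iff.1 hne
      exact .inr (.inr ⟨refl _, refl _⟩)
    obtain ⟨k, hk, hmin⟩ := exists_min_mem hne
    simp only [List.mem_append] at hk hmin
    have hkA : ∀ x ∈ A, k ≤ x := fun x hx => hmin x (.inl hx)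
    have hkB : ∀ x ∈ B, k ≤ x := fun x hx => hmin x (.inr hx)
    rcases hk with hk | hk
    · exact (key k A B hn hkA hkB hk).mono (hA k hk)
    · exact (key k B A (by omega) hkB hkA hk).symm.mono (hB k hk)

/-- Worms with modalities at least `m` are linearly ordered by `<_m`, up to equivalence. -/
theorem comparable {m : Ordinal.{u}} {A B : List Ordinal.{u}} (hA : ∀ x ∈ A, m ≤ x)
    (hB : ∀ x ∈ B, m ≤ x) : Comparable m A B :=
  comparable_aux _ m A B le_rfl hA hB

/-! ### A model in which all worms are satisfiable -/

/-- The least ordinal that is not a value of `mexLog` arbitrarily close to `x` from below. -/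
noncomputable def mexLog (x : Ordinal.{0}) : Ordinal.{0} :=
  sInf {z | ¬ ∀ a < x, ∃ y, ∃ _ : y < x, a < y ∧ mexLog y = z}
termination_by x

theorem exists_mexLog_eq {x z a : Ordinal.{0}} (hz : z < mexLog x) (ha : a < x) :
    ∃ y, a < y ∧ y < x ∧ mexLog y = z := by
  rw [mexLog] at hz
  have h := notMem_of_lt_csInf' hz
  simp only [mem_ofPred_eq, not_not] at h
  obtain ⟨y, hy, h₁, h₂⟩ := h a ha
  exact ⟨y, h₁, hy, h₂⟩

/-- The defining condition is vacuous at `0`, so this is the default `sInf ∅ = 0`. -/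
theorem mexLog_zero : mexLog 0 = 0 := by
  rw [mexLog]
  simp

theorem le_mexLog {x c : Ordinal.{0}} (hx : x ≠ 0)
    (h : ∀ z < c, ∀ a < x, ∃ y, a < y ∧ y < x ∧ mexLog y = z) : c ≤ mexLog x := by
  rw [mexLog]
  refine le_csInf ?_ fun z hz => ?_
  · obtain ⟨z, hz⟩ : BddAbove (mexLog '' Iio x) := Ordinal.bddAbove_of_small
    refine ⟨Order.succ z, fun h => ?_⟩
    obtain ⟨y, hy, -, hyz⟩ := h 0 (pos_iff_ne_zero.2 hx)
    exact (Order.lt_succ z).not_ge (hyz ▸ hz (mem_image_of_mem _ hy))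
  · by_contra hzc
    refine hz fun a ha => ?_
    obtain ⟨y, h₁, h₂, h₃⟩ := h z (not_le.1 hzc) a ha
    exact ⟨y, h₂, h₁, h₃⟩

/-- Closing off under the values below `c` gives a point where `mexLog` is at least `c`. At the
least such point beyond `a` it equals `c`, as a larger value would force an earlier occurrence of
`c`. -/
theorem exists_gt_mexLog_eq (c : Ordinal.{0}) : ∀ a : Ordinal.{0}, ∃ y, a < y ∧ mexLog y = c := by
  induction c using WellFoundedLT.induction with
  | ind c ih =>
    intro a
    choose! s hs using ih
    let g : Ordinal.{0} → Ordinal.{0} := fun b => Order.succ (b ⊔ ⨆ z : Iio c, s z b)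
    let x := ⨆ n, g^[n] a
    have hg : ∀ n, g^[n] a < x := fun n => by
      refine lt_of_lt_of_le ?_ (Ordinal.le_iSup _ (n + 1))
      rw [Function.iterate_succ_apply']
      exact Order.lt_succ_of_le le_sup_left
    have hx : c ≤ mexLog x := by
      refine le_mexLog (ne_bot_of_gt (hg 0)) fun z hz b hb => ?_
      obtain ⟨n, hn⟩ := Ordinal.lt_iSup_iff.1 hb
      refine ⟨s z (g^[n] a), hn.trans (hs z hz _).1, ?_, (hs z hz _).2⟩
      refine lt_of_lt_of_le ?_ (Ordinal.le_iSup _ (n + 1))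
      rw [Function.iterate_succ_apply']
      exact Order.lt_succ_of_le
        (le_sup_of_le_right (Ordinal.le_iSup (fun w : Iio c => s w _) ⟨z, hz⟩))
    obtain ⟨y, ⟨hy, hcy⟩, hmin⟩ := WellFounded.has_min (wellFounded_lt (α := Ordinal.{0}))
      {y | a < y ∧ c ≤ mexLog y} ⟨x, hg 0, hx⟩
    refine ⟨y, hy, hcy.antisymm' (not_lt.1 fun hlt => ?_)⟩
    obtain ⟨w, h₁, h₂, h₃⟩ := exists_mexLog_eq hlt hy
    exact hmin w ⟨h₁, h₃.ge⟩ h₂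

/-! ### Neighbourhood semantics on the ordinals -/

/-- The punctured neighbourhood filters of the `k`-th topology on the ordinals. -/
noncomputable def punctured : ℕ → Ordinal.{0} → Filter Ordinal.{0}
  | 0, x => 𝓟 (Iio x)
  | k + 1, x => 𝓝[<] x ⊓ comap mexLog (punctured k (mexLog x))

theorem punctured_succ_le (k : ℕ) : ∀ x, punctured (k + 1) x ≤ punctured k x := by
  induction k with
  | zero => exact fun x => inf_le_left.trans inf_le_right
  | succ k ih => exact fun x => inf_le_inf_left _ (comap_mono (ih _))

theorem punctured_antitone (x : Ordinal.{0}) : Antitone fun k => punctured k x :=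
  antitone_nat_of_succ_le fun k => punctured_succ_le k x

theorem eventually_lt_punctured (k : ℕ) (x : Ordinal.{0}) : ∀ᶠ y in punctured k x, y < x :=
  punctured_antitone x (Nat.zero_le k) (mem_principal_self _)

theorem eventually_eventually_nhdsLT {x : Ordinal.{0}} {p : Ordinal.{0} → Prop}
    (h : ∀ᶠ y in 𝓝[<] x, p y) : ∀ᶠ y in 𝓝[<] x, ∀ᶠ z in 𝓝[<] y, p z := by
  filter_upwards [eventually_eventually_nhdsWithin.2 h, self_mem_nhdsWithin] with y hy hyx
  exact hy.filter_mono (nhdsWithin_mono y (Iio_subset_Iio (le_of_lt hyx)))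

theorem eventually_eventually_nhdsLE {x : Ordinal.{0}} {p : Ordinal.{0} → Prop}
    (h : ∀ᶠ y in 𝓝[≤] x, p y) : ∀ᶠ y in 𝓝[≤] x, ∀ᶠ z in 𝓝[≤] y, p z := by
  filter_upwards [eventually_eventually_nhdsWithin.2 h, self_mem_nhdsWithin] with y hy hyx
  exact hy.filter_mono (nhdsWithin_mono y (Iic_subset_Iic.2 hyx))

theorem eventually_eventually_punctured (k : ℕ) : ∀ {x : Ordinal.{0}} {p : Ordinal.{0} → Prop},
    (∀ᶠ y in punctured k x, p y) → ∀ᶠ y in punctured k x, ∀ᶠ z in punctured k y, p z := by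
  induction k with
  | zero =>
    intro x p h
    simp only [punctured, eventually_principal, mem_Iio] at h ⊢
    exact fun y hy z hz => h z (hz.trans hy)
  | succ k ih =>
    intro x p h
    obtain ⟨s, hs, t, ⟨V, hV, hVt⟩, hst⟩ := mem_inf_iff.1 h
    have h₁ : ∀ᶠ y in punctured (k + 1) x, ∀ᶠ z in 𝓝[<] y, z ∈ s :=
      (eventually_eventually_nhdsLT hs).filter_mono inf_le_left
    have h₂ : ∀ᶠ y in punctured (k + 1) x, ∀ᶠ z in punctured k (mexLog y), z ∈ V :=
      (tendsto_comap.eventually (ih hV)).filter_mono inf_le_right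
    filter_upwards [h₁, h₂] with y h₁ h₂
    change {z | p z} ∈ _
    rw [show {z | p z} = s ∩ t from hst]
    have ht : t ∈ comap mexLog (punctured k (mexLog y)) := ⟨V, h₂, hVt⟩
    exact inter_mem (mem_inf_of_left h₁) (mem_inf_of_right ht)

/-- Transfinite induction on `x` works because these filters concentrate on points below `x`. -/
theorem loeb_punctured (k : ℕ) (A : Set Ordinal.{0}) (x : Ordinal.{0})
    (h : ∀ᶠ y in punctured k x, (∀ᶠ z in punctured k y, z ∈ A) → y ∈ A) :
    ∀ᶠ y in punctured k x, y ∈ A := by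
  induction x using WellFoundedLT.induction with
  | ind x ih =>
    filter_upwards [h, eventually_eventually_punctured k h, eventually_lt_punctured k x]
      with y h₁ h₂ h₃
    exact h₁ (ih y h₃ h₂)

/-- `mexLog` transfers the box of level `k+1` to that of level `k`; the forward direction uses that
each value below `mexLog x` is attained arbitrarily close to `x`. -/
theorem eventually_punctured_succ_iff {k : ℕ} {x : Ordinal.{0}} {A B : Set Ordinal.{0}}
    (h : ∀ᶠ y in 𝓝[<] x, (y ∈ A ↔ mexLog y ∈ B)) :
    (∀ᶠ y in punctured (k + 1) x, y ∈ A) ↔ ∀ᶠ z in punctured k (mexLog x), z ∈ B := by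
  constructor
  · intro hA
    rcases eq_or_ne x 0 with rfl | hx
    · rw [mexLog_zero]
      filter_upwards [eventually_lt_punctured k 0] with y hy
      simp at hy
    have hB : ∀ᶠ y in punctured (k + 1) x, mexLog y ∈ B := by
      filter_upwards [hA, h.filter_mono inf_le_left] with y h₁ h₂
      exact h₂.1 h₁
    obtain ⟨s, hs, t, ⟨V, hV, hVt⟩, hst⟩ := mem_inf_iff.1 hB
    obtain ⟨a, ha, has⟩ := (mem_nhdsLT_iff_exists_Ioo_subset' (pos_iff_ne_zero.2 hx)).1 hs
    filter_upwards [hV, eventually_lt_punctured k _] with z hzV hz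
    obtain ⟨y, h₁, h₂, rfl⟩ := exists_mexLog_eq hz ha
    have : y ∈ s ∩ t := ⟨has ⟨h₁, h₂⟩, hVt hzV⟩
    rw [← hst] at this
    exact this
  · intro hB
    filter_upwards [h.filter_mono inf_le_left,
      (tendsto_comap.eventually hB).filter_mono inf_le_right] with y h₁ h₂
    exact h₁.2 h₂

/-- Sets that locally from the left are, `n` times in succession, preimages under `mexLog`. -/
def Tame : ℕ → Set Ordinal.{0} → Prop
  | 0, _ => True
  | n + 1, A => ∀ x, ∃ B, Tame n B ∧ ∀ᶠ y in 𝓝[≤] x, (y ∈ A ↔ mexLog y ∈ B)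

theorem Tame.const (n : ℕ) (p : Prop) : Tame n {_x | p} := by
  induction n with
  | zero => trivial
  | succ n ih => exact fun x => ⟨_, ih, Eventually.of_forall fun y => Iff.rfl⟩

theorem Tame.himp {n : ℕ} : ∀ {A B : Set Ordinal.{0}}, Tame n A → Tame n B →
    Tame n {x | x ∈ A → x ∈ B} := by
  induction n with
  | zero => exact fun _ _ => trivial
  | succ n ih =>
    intro A B hA hB x
    obtain ⟨A', hA', h₁⟩ := hA x
    obtain ⟨B', hB', h₂⟩ := hB x
    refine ⟨_, ih hA' hB', ?_⟩
    filter_upwards [h₁, h₂] with y h₁ h₂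
    simp [h₁, h₂]

/-- The first failure of `A`, if below `x`, persists at all later points, so the level-0 box is
locally constant from the left. -/
theorem eventually_iff_of_forall_lt (x : Ordinal.{0}) (A : Set Ordinal.{0}) :
    ∃ p : Prop, ∀ᶠ y in 𝓝[≤] x, ((∀ z < y, z ∈ A) ↔ p) := by
  by_cases h : ∀ z < x, z ∈ A
  · refine ⟨True, ?_⟩
    filter_upwards [self_mem_nhdsWithin] with y hy
    exact iff_true_intro fun z hz => h z (lt_of_lt_of_le hz hy)
  · push Not at h
    obtain ⟨z, hz, hzA⟩ := h
    refine ⟨False, ?_⟩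
    filter_upwards [Ioc_mem_nhdsLE hz] with y hy
    exact iff_false_intro fun h => hzA (h z hy.1)

theorem Tame.box (k : ℕ) : ∀ {n : ℕ} {A : Set Ordinal.{0}}, Tame n A →
    Tame n {x | ∀ᶠ y in punctured k x, y ∈ A} := by
  induction k with
  | zero =>
    intro n A _
    cases n with
    | zero => trivial
    | succ n =>
      intro x
      obtain ⟨p, hp⟩ := eventually_iff_of_forall_lt x A
      exact ⟨_, Tame.const n p, hp⟩
  | succ k ih =>
    intro n A hA
    cases n with
    | zero => trivial
    | succ n =>
      intro x
      obtain ⟨B, hB, h⟩ := hA x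
      refine ⟨_, ih hB, ?_⟩
      filter_upwards [eventually_eventually_nhdsLE h] with y hy
      exact eventually_punctured_succ_iff (hy.filter_mono (nhdsWithin_mono y Iio_subset_Iic_self))

/-- Soundness of `⟨α⟩ψ → [β]⟨α⟩ψ`. Tameness allows descending `j` times through `mexLog` to level 0,
where a single counterexample below `x` serves all nearby points. -/
theorem eventually_not_box {j k : ℕ} (hjk : j < k) : ∀ {A : Set Ordinal.{0}}, Tame j A →
    ∀ {x : Ordinal.{0}}, ¬ (∀ᶠ y in punctured j x, y ∈ A) →
      ∀ᶠ y in punctured k x, ¬ ∀ᶠ z in punctured j y, z ∈ A := by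
  obtain ⟨k, rfl⟩ : ∃ i, k = i + 1 := ⟨k - 1, by omega⟩
  induction j generalizing k with
  | zero =>
    intro A _ x hx
    simp only [punctured, eventually_principal, mem_Iio] at hx ⊢
    push Not at hx ⊢
    obtain ⟨z, hz, hzA⟩ := hx
    have : ∀ᶠ y in 𝓝[<] x, ∃ w < y, w ∉ A := by
      filter_upwards [Ioo_mem_nhdsLT hz] with y hy
      exact ⟨z, hy.1, hzA⟩
    exact this.filter_mono inf_le_left
  | succ j ih =>
    intro A hA x hx
    obtain ⟨k, rfl⟩ : ∃ i, k = i + 1 := ⟨k - 1, by omega⟩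
    obtain ⟨B, hB, h⟩ := hA x
    have h' := h.filter_mono (nhdsWithin_mono x Iio_subset_Iic_self)
    rw [eventually_punctured_succ_iff h'] at hx
    have h₁ := ih k (by omega) hB hx
    filter_upwards [(tendsto_comap.eventually h₁).filter_mono inf_le_right,
      (eventually_eventually_nhdsLT h').filter_mono inf_le_left] with y h₁ h₂
    rwa [eventually_punctured_succ_iff h₂]

/-- Interpretation of formulas, `[α]` being the box of the `f α`-th topology. -/
def sem (f : Ordinal.{u} → ℕ) : Formula.{u} → Set Ordinal.{0}
  | var _ => {_x | False}
  | bot => {_x | False}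
  | imp φ ψ => {x | x ∈ sem f φ → x ∈ sem f ψ}
  | box α φ => {x | ∀ᶠ y in punctured (f α) x, y ∈ sem f φ}

theorem tame_sem (f : Ordinal.{u} → ℕ) (n : ℕ) (φ : Formula.{u}) : Tame n (sem f φ) := by
  induction φ with
  | var _ => exact Tame.const n False
  | bot => exact Tame.const n False
  | imp φ ψ h₁ h₂ => exact h₁.himp h₂
  | box α φ h => exact h.box (f α)

theorem eval_mem_sem (f : Ordinal.{u} → ℕ) (x : Ordinal.{0}) (φ : Formula.{u}) :
    eval (fun ψ => x ∈ sem f ψ) φ ↔ x ∈ sem f φ := by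
  induction φ with
  | var _ => rfl
  | bot => rfl
  | imp φ ψ h₁ h₂ => exact imp_congr h₁ h₂
  | box α φ _ => rfl

theorem mem_sem_dia {f : Ordinal.{u} → ℕ} {x : Ordinal.{0}} {a : Ordinal.{u}} {φ : Formula.{u}} :
    x ∈ sem f (dia a φ) ↔ ∃ᶠ y in punctured (f a) x, y ∈ sem f φ := Iff.rfl

/-! ### Soundness and consistency of worms -/

/-- A derivation uses finitely many axiom instances, so only finitely many modalities need to be
mapped to levels in order. -/
theorem Provable.sound {φ : Formula.{u}} (h : Provable φ) : ∃ F : Finset Ordinal.{u},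
    ∀ f : Ordinal.{u} → ℕ, StrictMonoOn f F → ∀ x, x ∈ sem f φ := by
  classical
  induction h with
  | taut h => exact ⟨∅, fun f _ x => (eval_mem_sem f x _).1 (h _)⟩
  | distrib α χ ψ =>
    refine ⟨∅, fun f _ x h₁ h₂ => ?_⟩
    exact Eventually.mp h₂ h₁
  | loeb α χ => exact ⟨∅, fun f _ x h => loeb_punctured _ _ x h⟩
  | @dia_box α β h ψ =>
    refine ⟨{α, β}, fun f hf x hx => ?_⟩
    exact eventually_not_box (hf (by simp) (by simp) h) (tame_sem f _ (neg ψ)) hx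
  | @monotone α β h ψ =>
    refine ⟨{α, β}, fun f hf x hx => ?_⟩
    exact Eventually.filter_mono (punctured_antitone x (hf.monotoneOn (by simp) (by simp) h)) hx
  | mp _ _ ih₁ ih₂ =>
    obtain ⟨F₁, h₁⟩ := ih₁
    obtain ⟨F₂, h₂⟩ := ih₂
    refine ⟨F₁ ∪ F₂, fun f hf x => ?_⟩
    exact h₁ f (hf.mono (by simp)) x (h₂ f (hf.mono (by simp)) x)
  | nec α _ ih =>
    obtain ⟨F, h⟩ := ih
    exact ⟨F, fun f hf x => Eventually.of_forall (h f hf)⟩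

theorem exists_strictMonoOn (F : Finset Ordinal.{u}) :
    ∃ f : Ordinal.{u} → ℕ, StrictMonoOn f F := by
  classical
  refine ⟨fun a => (F.filter (· < a)).card, fun a ha b _ hab => Finset.card_lt_card ?_⟩
  refine Finset.ssubset_iff_of_subset (fun x hx => ?_) |>.2 ⟨a, by simpa using ⟨ha, hab⟩, by simp⟩
  rw [Finset.mem_filter] at hx ⊢
  exact ⟨hx.1, hx.2.trans hab⟩

/-- Points at which every worm of length `l` with modalities at most `k` holds. -/
def deep (k : ℕ) : ℕ → Set Ordinal.{0}
  | 0 => univ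
  | l + 1 => {x | ∃ᶠ y in punctured k x, y ∈ deep k l}

theorem mem_deep_succ_iff (k l : ℕ) : ∀ x, x ∈ deep (k + 1) l ↔ mexLog x ∈ deep k l := by
  induction l with
  | zero => exact fun x => Iff.rfl
  | succ l ih =>
    intro x
    have h : ∀ᶠ y in 𝓝[<] x, (y ∈ (deep (k + 1) l)ᶜ ↔ mexLog y ∈ (deep k l)ᶜ) :=
      Eventually.of_forall fun y => not_congr (ih y)
    exact not_congr (eventually_punctured_succ_iff h)

theorem deep_nonempty (k l : ℕ) : (deep k l).Nonempty := by
  induction k with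
  | zero =>
    refine ⟨l, ?_⟩
    induction l with
    | zero => trivial
    | succ l ih =>
      refine frequently_principal.2 ⟨l, ?_, ih⟩
      rw [mem_Iio]
      exact_mod_cast Nat.lt_succ_self l
  | succ k ih =>
    obtain ⟨x, hx⟩ := ih
    obtain ⟨y, -, rfl⟩ := exists_gt_mexLog_eq x 0
    exact ⟨y, (mem_deep_succ_iff k l y).2 hx⟩

theorem deep_subset_sem_worm {f : Ordinal.{u} → ℕ} {k : ℕ} {A : List Ordinal.{u}}
    (hA : ∀ a ∈ A, f a ≤ k) : deep k A.length ⊆ sem f (worm A) := by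
  induction A with
  | nil => exact fun x _ h => h
  | cons a A ih =>
    rw [List.forall_mem_cons] at hA
    intro x hx
    exact mem_sem_dia.2 (Frequently.filter_mono (Frequently.mono hx fun y hy => ih hA.2 hy)
      (punctured_antitone x hA.1))

theorem not_provable_neg_worm (A : List Ordinal.{u}) : ¬ Provable (neg (worm A)) := by
  intro h
  obtain ⟨F, hF⟩ := h.sound
  obtain ⟨f, hf⟩ := exists_strictMonoOn F
  -- The sum is merely a convenient upper bound for all levels occurring in `A`.
  obtain ⟨x, hx⟩ := deep_nonempty (A.map f).sum A.length
  refine hF f hf x (deep_subset_sem_worm (fun a ha => ?_) hx)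
  exact List.single_le_sum (by simp) _ (List.mem_map_of_mem ha)

/-! ### Well-foundedness -/

/-- The order `<_0` on lists of modalities. -/
def listLT (A B : List Ordinal.{u}) : Prop := Entails (worm B) (dia 0 (worm A))

theorem not_listLT_of_above {A B : List Ordinal.{u}} (h : Above 0 A B) : ¬ listLT B A := by
  intro h'
  refine not_provable_neg_worm A (Entails.refutable (a := 0) ?_)
  rcases h with h | h
  · exact h'.trans (dia_mono 0 h)
  · exact h'.trans_dia h

theorem acc_of_above {A B : List Ordinal.{u}} (hB : Acc listLT B) (h : Above 0 A B) :
    Acc listLT A := by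
  rcases h with h | h
  · exact ⟨_, fun C hC => hB.inv (h.trans hC)⟩
  · exact hB.inv h

/-- A worm outside the well-founded part such that all shorter worms below it are inside. -/
def MinimalBad (A : List Ordinal.{u}) : Prop :=
  ¬ Acc listLT A ∧ ∀ B : List Ordinal.{u}, B.length < A.length → Above 0 B A → Acc listLT B

theorem exists_minimalBad {C : List Ordinal.{u}} (hC : ¬ Acc listLT C) :
    ∃ A, MinimalBad A ∧ Above 0 A C := by
  obtain ⟨A, ⟨hA, hAC⟩, hmin⟩ := WellFounded.has_min
    (InvImage.wf List.length (wellFounded_lt (α := ℕ)))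
    {A : List Ordinal.{u} | ¬ Acc listLT A ∧ Above 0 A C} ⟨C, hC, .inl (refl _)⟩
  exact ⟨A, ⟨hA, fun B hB hBA => by_contra fun h => hmin B ⟨h, hBA.trans hAC⟩ hB⟩, hAC⟩

theorem MinimalBad.exists_split {A : List Ordinal.{u}} (hA : MinimalBad A) :
    ∃ m h b, A = h ++ m :: b ∧ (∀ x ∈ h, m < x) ∧ ∀ x ∈ b, m ≤ x := by
  have hne : A ≠ [] := by
    rintro rfl
    refine hA.1 ⟨_, fun C hC => (not_listLT_of_above ?_ hC).elim⟩
    exact .inl (to_top _)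
  obtain ⟨m, hm, hmin⟩ := exists_min_mem hne
  exact ⟨m, GLP.exists_split hmin hm⟩

theorem MinimalBad.acc_left {m : Ordinal.{u}} {h b : List Ordinal.{u}}
    (hA : MinimalBad (h ++ m :: b)) : Acc listLT h :=
  hA.2 h (by simp) (.inl (worm_append_left _ _))

theorem MinimalBad.acc_right {m : Ordinal.{u}} {h b : List Ordinal.{u}}
    (hA : MinimalBad (h ++ m :: b)) (hh : ∀ x ∈ h, m < x) : Acc listLT b :=
  hA.2 b (by simp; omega) (.inr ((worm_append_right hh b).trans (dia_of_le zero_le _)))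

theorem wellFounded_listLT : WellFounded listLT.{u} := by
  refine ⟨fun A₀ => by_contra fun hA₀ => ?_⟩
  let M : Set Ordinal.{u} := {m | ∃ h b, (∀ x ∈ h, m < x) ∧ (∀ x ∈ b, m ≤ x) ∧
    MinimalBad (h ++ m :: b)}
  have hM : ∀ {A}, MinimalBad A → ∃ m ∈ M, ∃ h b, A = h ++ m :: b ∧ (∀ x ∈ h, m < x) ∧
      ∀ x ∈ b, m ≤ x := by
    intro A hA
    obtain ⟨m, h, b, rfl, hh, hb⟩ := hA.exists_split
    exact ⟨m, ⟨h, b, hh, hb, hA⟩, h, b, rfl, hh, hb⟩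
  obtain ⟨A₁, hA₁, -⟩ := exists_minimalBad hA₀
  obtain ⟨m₁, hm₁, -⟩ := hM hA₁
  obtain ⟨m, hm, hmin⟩ := WellFounded.has_min (wellFounded_lt (α := Ordinal.{u})) M ⟨m₁, hm₁⟩
  obtain ⟨h₀, b₀, hh₀, hb₀, hbad₀⟩ := hm
  suffices H : ∀ h, Acc listLT h → ∀ b, (∀ x ∈ h, m < x) → (∀ x ∈ b, m ≤ x) →
      ¬ MinimalBad (h ++ m :: b) from H h₀ hbad₀.acc_left b₀ hh₀ hb₀ hbad₀
  -- The remainder `b` stays universally quantified, since the induction passes to a worm with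
  -- another remainder.
  intro h hacc
  induction hacc with
  | intro h hacc ih =>
  intro b hh hb hbad
  obtain ⟨C, hCA, hC⟩ : ∃ C, listLT C (h ++ m :: b) ∧ ¬ Acc listLT C := by
    by_contra! H
    exact hbad.1 ⟨_, H⟩
  obtain ⟨A, hA, hAC⟩ := exists_minimalBad hC
  have hlt : listLT A (h ++ m :: b) := by
    rcases hAC with hAC | hAC
    · exact hCA.trans (dia_mono 0 hAC)
    · exact hCA.trans_dia hAC
  obtain ⟨m', hm', h', b', rfl, hh', hb'⟩ := hM hA
  have hmm' : m ≤ m' := not_lt.1 (hmin m' hm')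
  have hle : ∀ x ∈ h' ++ m' :: b', m ≤ x := by
    intro x hx
    rcases List.mem_append.1 hx with hx | hx
    · exact hmm'.trans (hh' x hx).le
    · rcases List.mem_cons.1 hx with rfl | hx
      · exact hmm'
      · exact hmm'.trans (hb' x hx)
  have hbA : Entails (worm (h' ++ m' :: b')) (dia m (worm b)) := by
    rcases (comparable hb hle).lt_or_above with h₁ | h₁
    · exact h₁
    · exact (hA.1 (acc_of_above (hbad.acc_right hh) (h₁.mono zero_le))).elim
  have hnot : ¬ Above (Order.succ m) h (h' ++ m' :: b') := fun H =>
    not_listLT_of_above ((H.append hh hbA).mono zero_le) hlt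
  -- For `m < m'` the whole of `A` can be compared with `h` at level `m+1`; for `m = m'` only its
  -- head can.
  rcases hmm'.lt_or_eq with hlt' | rfl
  · have hA' : ∀ x ∈ h' ++ m' :: b', Order.succ m ≤ x := by
      intro x hx
      refine Order.succ_le_of_lt ?_
      rcases List.mem_append.1 hx with hx | hx
      · exact hlt'.trans (hh' x hx)
      · rcases List.mem_cons.1 hx with rfl | hx
        · exact hlt'
        · exact hlt'.trans_le (hb' x hx)
    rcases comparable (fun x hx => Order.succ_le_of_lt (hh x hx)) hA' with h₁ | h₁ | h₁
    · exact hnot (.inr h₁)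
    · exact hA.1 (acc_of_above ⟨_, hacc⟩ (.inr (h₁.trans (dia_of_le zero_le _))))
    · exact hnot (.inl h₁.2)
  · have hleft := worm_append_left h' (m :: b')
    rcases comparable (fun x hx => Order.succ_le_of_lt (hh x hx))
      (fun x hx => Order.succ_le_of_lt (hh' x hx)) with h₁ | h₁ | h₁
    · exact hnot (.inr (hleft.trans h₁))
    · exact ih h' (h₁.trans (dia_of_le zero_le _)) b' hh' hb' hA
    · exact hnot (.inl (hleft.trans h₁.2))

end GLP

theorem mainTheorem7 (α : Ordinal.{u}) : GLP.S.{u}.WellFoundedOn (GLP.wormLT α) := by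
  choose l hl using fun A : GLP.S.{u} => GLP.IsWorm.exists_list A.2
  refine Subrelation.wf ?_ (InvImage.wf l GLP.wellFounded_listLT)
  intro A B h
  change GLP.Entails (GLP.worm (l B)) (GLP.Formula.dia 0 (GLP.worm (l A)))
  rw [hl, hl]
  exact GLP.Entails.trans h (GLP.Entails.dia_of_le zero_le _)
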